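/- Let $K$ be a flag simplicial complex on a finite vertex set (every vertex is a simplex, and every minimal non-face has exactly two elements). Let $f_i$ be the number of $i$-dimensional simplices of $K$ (so $f_i=0$ for $i>\dim K$), and for $n\ge 1$ put $\alpha_n=\sum_{i=0}^{n-1} f_i\binom{n-1}{i}$. For $d\ge 1$ let $p_d(s_1,s_2,\dots)$ be the $d$-th Newton polynomial, i.e. the integer polynomial with $p_d(\sigma_1,\sigma_2,\dots)=\sum_j\gamma_j^d$, where $\sigma_i$ is the $i$-th elementary symmetric polynomial in the variables $\gamma_j$. Let $\mu$ be the Möbius function, and let $$Q(t)=\Bigl(1+\sum_{i=0}^{\dim K}(-1)^{i+1}f_i\frac{t^{i+1}}{(1+t)^{i+1}}\Bigr)^{-1}=1+q_1t+q_2t^2+\cdots\in\mathbb Q[[t]].$$ Then: 1. For every $N\ge 1$, $\;(-1)^{N+1}\sum_{d\mid N}\mu(N/d)\,p_d(q_1,q_2,\dots)\ge 0$. 2. For every $N\ge 1$, $\;(-1)^{N}\sum_{d\mid N}\mu(N/d)(-1)^d p_d(\alpha_1,\alpha_2,\dots)\ge 0$. 3. There is a graded rational vector space $V=\bigoplus_{i\ge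 1}V^i$, finite-dimensional in each degree, such that $Q(t)$ is the Poincaré series of the free graded commutative algebra $S(V)=\mathrm{Sym}(V^{\mathrm{even}})\otimes\Lambda(V^{\mathrm{odd}})$ and, for every $N\ge 1$, the left-hand side of the inequality in 2 equals $N\dim V^N$. 4. $f_2\ge\binom{f_0}{3}-(f_0-2)\bigl(\binom{f_0}{2}-f_1\bigr)$. -/

import Mathlib

namespace FlagComplex

/-! ### Simplicial complexes

Mathlib's `AbstractSimplicialComplex ι` lists only the nonempty simplices and contains every
one-element subset of `ι`; the empty simplex is understood. -/

/-- The number `f_i` of `i`-dimensional simplices of `K`, i.e. of simplices with `i + 1` vertices.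
It is `0` for `i` larger than the dimension of `K`. -/
noncomputable def faceNumber {ι : Type*} (K : AbstractSimplicialComplex ι) (i : ℕ) : ℕ :=
  Set.ncard {s : Finset ι | s ∈ K ∧ s.card = i + 1}

/-- A minimal non-face: a (nonempty) set of vertices that is not a simplex, all of whose proper
(nonempty) subsets are simplices. -/
def IsMinimalNonface {ι : Type*} (K : AbstractSimplicialComplex ι) (s : Finset ι) : Prop :=
  s.Nonempty ∧ s ∉ K ∧ ∀ t : Finset ι, t ⊂ s → t.Nonempty → t ∈ K

/-- `K` is flag: all its minimal non-faces are two-element sets. -/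
def IsFlag {ι : Type*} (K : AbstractSimplicialComplex ι) : Prop :=
  ∀ s : Finset ι, IsMinimalNonface K s → s.card = 2

/-- `α_n = ∑_{i=0}^{n-1} f_i * C(n-1, i)`, used for `n ≥ 1`. -/
noncomputable def alpha {ι : Type*} (K : AbstractSimplicialComplex ι) (n : ℕ) : ℤ :=
  ∑ i ∈ Finset.range n, (faceNumber K i : ℤ) * ((n - 1).choose i : ℤ)

open PowerSeries in
/-- The power series `(1 + ∑_i (-1)^(i+1) f_i t^(i+1) / (1+t)^(i+1))⁻¹`. A simplex has at most
`Fintype.card ι` vertices, so the sum runs over all `i ≤ dim K` (further terms vanish). The series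
that are inverted have constant term `1`. -/
noncomputable def flagSeries {ι : Type*} [Fintype ι] (K : AbstractSimplicialComplex ι) :
    PowerSeries ℚ :=
  (1 + ∑ i ∈ Finset.range (Fintype.card ι),
    C ((-1 : ℚ) ^ (i + 1) * (faceNumber K i : ℚ)) * (X ^ (i + 1) * ((1 + X) ^ (i + 1))⁻¹))⁻¹

/-! ### Newton polynomials -/

/-- The `d`-th Newton polynomial: the unique polynomial over `ℤ` that expresses the power sum
`γ_1^d + ⋯ + γ_d^d` through the elementary symmetric polynomials of `γ_1, …, γ_d`. The variable
with index `i : Fin d` stands for the elementary symmetric polynomial of degree `i + 1`. -/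
noncomputable def newtonPoly (d : ℕ) : MvPolynomial (Fin d) ℤ :=
  (MvPolynomial.esymmAlgEquiv (Fin d) ℤ (Fintype.card_fin d)).symm
    ⟨MvPolynomial.psum (Fin d) ℤ d, MvPolynomial.psum_isSymmetric (Fin d) ℤ d⟩

/-- `p_d(s_1, s_2, …)`. -/
noncomputable def newton {R : Type*} [CommRing R] (s : ℕ → R) (d : ℕ) : R :=
  MvPolynomial.aeval (fun i : Fin d => s (i + 1)) (newtonPoly d)

/-! ### Free graded commutative algebras -/

open scoped DirectSum TensorProduct

variable (k : Type*) [Field k] (V : ℕ → Type*) [∀ i, AddCommGroup (V i)] [∀ i, Module k (V i)]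

/-- The free graded commutative algebra `S(V)` on the graded vector space `V^1 ⊕ V^2 ⊕ ⋯`
(the component `V 0` plays no role): the symmetric algebra of the even part tensored with the
exterior algebra of the odd part. -/
abbrev FreeGradedComm : Type _ :=
  SymmetricAlgebra k (⨁ j : ℕ, V (2 * j + 2)) ⊗[k] ExteriorAlgebra k (⨁ j : ℕ, V (2 * j + 1))

/-- The inclusion of the generators of degree `2j + 2`. -/
noncomputable def evenGen (j : ℕ) (v : V (2 * j + 2)) : FreeGradedComm k V :=
  SymmetricAlgebra.ι k _ (DirectSum.lof k ℕ (fun j => V (2 * j + 2)) j v) ⊗ₜ[k] 1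

/-- The inclusion of the generators of degree `2j + 1`. -/
noncomputable def oddGen (j : ℕ) (v : V (2 * j + 1)) : FreeGradedComm k V :=
  1 ⊗ₜ[k] ExteriorAlgebra.ι k (DirectSum.lof k ℕ (fun j => V (2 * j + 1)) j v)

/-- `IsMonomial k V n x`: `x` is a product of homogeneous generators of total degree `n`. -/
inductive IsMonomial : ℕ → FreeGradedComm k V → Prop
  | one : IsMonomial 0 1
  | even_mul (j : ℕ) (v : V (2 * j + 2)) {n : ℕ} {x : FreeGradedComm k V} :
      IsMonomial n x → IsMonomial (2 * j + 2 + n) (evenGen k V j v * x)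
  | odd_mul (j : ℕ) (v : V (2 * j + 1)) {n : ℕ} {x : FreeGradedComm k V} :
      IsMonomial n x → IsMonomial (2 * j + 1 + n) (oddGen k V j v * x)

/-- The homogeneous component of degree `n` of `S(V)`. -/
def gradedPiece (n : ℕ) : Submodule k (FreeGradedComm k V) :=
  Submodule.span k {x | IsMonomial k V n x}

/-- The Poincaré series of `S(V)`, for `V` of finite dimension in each degree. -/
noncomputable def poincareSeries : PowerSeries ℚ :=
  PowerSeries.mk fun n => (Module.finrank k (gradedPiece k V n) : ℚ)

end FlagComplex

namespace FlagComplex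

open PowerSeries

/-! ### Power series with natural coefficients -/

/-! Since `K` is flag, its nonempty simplices are the nonempty cliques of its 1-skeleton, so `Q` is
the inverse of the clique polynomial at `x = -t/(1+t)` (`IsFlag.flagSeries_eq`). All four statements
come from one expansion: `Q` is the product of `(1+t^i)^(v i)` over odd `i` and `(1-t^i)^(-v i)`
over even `i`, with natural numbers `v i`.

Existence of the expansion: let `C_S` be the clique series of a vertex set `S`, and `L` the set of
neighbours in `S` of a new vertex. Then `C_(S+v) = C_S + x C_L`, hence `1/C_(S+v) = (1/C_S) (1+t) /
(1-R)` with `R = t (C_L/C_S - 1)`. By `ratio_mem_natSeries` the coefficients of `R` are natural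
numbers, and for such `R` the series `1/(1-R)` has an expansion, found by removing factors degree by
degree (`exists_hasSuperExponents_inv_one_sub`). Induction on the vertices finishes.

Consequences: `1/Q = 1 + ∑ (-1)^n α_n t^n` is formally `∏ (1 - γ t)`, so `t Q'/Q` is the generating
series of the `p_d(α)`. Comparing it with the logarithmic derivative of the product and applying
Möbius inversion gives `N * v N` for the expression in statement 2. Replacing `α` by `q` multiplies
`p_d` by `-(-1)^d`, which gives statement 1. Counting monomials identifies the product with the
Poincaré series of `S(V)`, `dim V^i = v i`. Statement 4 is the case `N = 3`. -/

/-- The power series whose coefficients are natural numbers. -/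
noncomputable def natSeries : Subsemiring ℚ⟦X⟧ := (PowerSeries.map (Nat.castRingHom ℚ)).rangeS

lemma mem_natSeries {F : ℚ⟦X⟧} : F ∈ natSeries ↔ ∀ n, ∃ k : ℕ, coeff n F = k := by
  constructor
  · rintro ⟨G, rfl⟩ n
    exact ⟨coeff n G, by simp⟩
  · intro h
    choose f hf using h
    exact ⟨PowerSeries.mk f, by ext n; simp [hf]⟩

lemma X_mem_natSeries : (X : ℚ⟦X⟧) ∈ natSeries := ⟨X, by simp⟩

/-- The inverse `F` satisfies `F = 1 + R F`; as `R` has no constant term, each coefficient of `F` is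
a natural combination of earlier ones. -/
lemma inv_one_sub_mem_natSeries {R : ℚ⟦X⟧} (hR : R ∈ natSeries) (h0 : constantCoeff R = 0) :
    (1 - R)⁻¹ ∈ natSeries := by
  rw [mem_natSeries]
  have hF : (1 - R)⁻¹ = 1 + R * (1 - R)⁻¹ := by
    have : (1 - R) * (1 - R)⁻¹ = 1 := PowerSeries.mul_inv_cancel _ (by simp [h0])
    linear_combination this
  intro n
  induction n using Nat.strong_induction_on with
  | _ n ih =>
    choose! f hf using ih
    choose g hg using mem_natSeries.mp hR
    rw [hF, map_add, coeff_mul, coeff_one]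
    refine ⟨(if n = 0 then 1 else 0) + ∑ p ∈ Finset.HasAntidiagonal.antidiagonal n,
      if p.1 = 0 then 0 else g p.1 * f p.2, ?_⟩
    push_cast
    congr 1
    refine Finset.sum_congr rfl fun p hp => ?_
    rw [Finset.HasAntidiagonal.mem_antidiagonal] at hp
    split_ifs with h
    · rw [h, coeff_zero_eq_constantCoeff_apply, h0, zero_mul]
    · rw [hg, hf _ (by omega)]

lemma sub_X_pow_mem_natSeries {R : ℚ⟦X⟧} {m k : ℕ} (hR : R ∈ natSeries)
    (hk : coeff m R = (k + 1 : ℕ)) : R - X ^ m ∈ natSeries := by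
  rw [mem_natSeries] at hR ⊢
  intro n
  rw [map_sub, coeff_X_pow]
  split_ifs with h
  · exact ⟨k, by rw [h, hk]; push_cast; ring⟩
  · simpa using hR n

/-! ### Super exponents -/

/-- The Poincaré series of the free graded commutative algebra on one generator of degree `m`. -/
noncomputable def superFactor (m : ℕ) : ℚ⟦X⟧ := if Odd m then 1 + X ^ m else (1 - X ^ m)⁻¹

/-- `F` is the infinite product of the series `superFactor i ^ v i`, `i ≥ 1`. -/
def HasSuperExponents (F : ℚ⟦X⟧) (v : ℕ → ℕ) : Prop :=
  ∀ N, X ^ (N + 1) ∣ F - ∏ i ∈ Finset.range N, superFactor (i + 1) ^ v (i + 1)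

lemma constantCoeff_one_sub_X_pow {m : ℕ} (hm : 1 ≤ m) :
    constantCoeff (1 - X ^ m : ℚ⟦X⟧) = 1 := by
  simp [zero_pow (show m ≠ 0 by omega)]

lemma one_sub_X_pow_mul_inv {m : ℕ} (hm : 1 ≤ m) :
    (1 - X ^ m : ℚ⟦X⟧) * (1 - X ^ m)⁻¹ = 1 :=
  PowerSeries.mul_inv_cancel _ (by rw [constantCoeff_one_sub_X_pow hm]; exact one_ne_zero)

/-- The error `Z` is `X^(2m)` for odd `m` and `0` for even `m`; having natural coefficients and
higher order, it can be absorbed into a remainder. -/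
lemma superFactor_spec {m : ℕ} (hm : 1 ≤ m) : superFactor m ∈ natSeries ∧
    (∃ G, superFactor m = 1 + X ^ m * G) ∧
    ∃ Z ∈ natSeries, X ^ (m + 1) ∣ Z ∧ (1 - X ^ m) * superFactor m = 1 - Z := by
  unfold superFactor
  split_ifs with h
  · refine ⟨add_mem (one_mem _) (pow_mem X_mem_natSeries _), ⟨1, by ring⟩, X ^ (2 * m),
      pow_mem X_mem_natSeries _, pow_dvd_pow _ (by omega), by ring⟩
  · refine ⟨inv_one_sub_mem_natSeries (pow_mem X_mem_natSeries _)
      (by simp [zero_pow (show m ≠ 0 by omega)]), ⟨(1 - X ^ m)⁻¹, ?_⟩, 0, zero_mem _,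
      dvd_zero _, ?_⟩
    · linear_combination one_sub_X_pow_mul_inv hm
    · rw [one_sub_X_pow_mul_inv hm, sub_zero]

/-- With `E = superFactor m`, one has `(1-R) E = (1-X^m) E - (R-X^m) E = 1 - (Z + (R-X^m) E)`. The
new remainder keeps natural coefficients, and its coefficient at `X^m` has dropped by one. -/
lemma exists_one_sub_mul_superFactor {R : ℚ⟦X⟧} {m k : ℕ} (hm : 1 ≤ m) (hR : R ∈ natSeries)
    (hd : X ^ m ∣ R) (hk : coeff m R = (k + 1 : ℕ)) :
    ∃ R' ∈ natSeries, X ^ m ∣ R' ∧ coeff m R' = k ∧ (1 - R) * superFactor m = 1 - R' := by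
  obtain ⟨hE, ⟨G, hG⟩, Z, hZ, hZd, hEZ⟩ := superFactor_spec hm
  refine ⟨(R - X ^ m) * superFactor m + Z,
    add_mem (mul_mem (sub_X_pow_mem_natSeries hR hk) hE) hZ, ?_, ?_, ?_⟩
  · exact dvd_add (Dvd.dvd.mul_right (dvd_sub hd dvd_rfl) _) ((pow_dvd_pow _ (by omega)).trans hZd)
  · have h1 : X ^ (m + 1) ∣ (R - X ^ m) * (X ^ m * G) := by
      obtain ⟨S, rfl⟩ := hd
      refine (pow_dvd_pow X (show m + 1 ≤ m + m by omega)).trans ⟨(S - 1) * G, by ring⟩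
    have h2 := X_pow_dvd_iff.mp h1 m (by omega)
    have h3 := X_pow_dvd_iff.mp hZd m (by omega)
    rw [hG, mul_add, mul_one, map_add, map_add, h2, h3, map_sub, hk, coeff_X_pow_self]
    push_cast
    ring
  · linear_combination hEZ

lemma exists_one_sub_mul_superFactor_pow {m : ℕ} (hm : 1 ≤ m) (k : ℕ) {R : ℚ⟦X⟧}
    (hR : R ∈ natSeries) (hd : X ^ m ∣ R) (hk : coeff m R = k) :
    ∃ R' ∈ natSeries, X ^ (m + 1) ∣ R' ∧ (1 - R) * superFactor m ^ k = 1 - R' := by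
  induction k generalizing R with
  | zero =>
    refine ⟨R, hR, X_pow_dvd_iff.mpr fun n hn => ?_, by simp⟩
    rcases Nat.lt_succ_iff_lt_or_eq.mp hn with h | rfl
    · exact X_pow_dvd_iff.mp hd n h
    · simpa using hk
  | succ k ih =>
    obtain ⟨R₁, h1, h2, h3, h4⟩ := exists_one_sub_mul_superFactor hm hR hd hk
    obtain ⟨R₂, g1, g2, g3⟩ := ih h1 h2 h3
    exact ⟨R₂, g1, g2, by rw [← g3, ← h4]; ring⟩

lemma exists_hasSuperExponents_inv_one_sub {R : ℚ⟦X⟧} (hR : R ∈ natSeries)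
    (h0 : constantCoeff R = 0) : ∃ v, HasSuperExponents (1 - R)⁻¹ v := by
  have step : ∀ (m : ℕ) (R : {R : ℚ⟦X⟧ // R ∈ natSeries ∧ X ^ (m + 1) ∣ R}),
      ∃ (k : ℕ) (R' : {R : ℚ⟦X⟧ // R ∈ natSeries ∧ X ^ (m + 1 + 1) ∣ R}),
        (1 - R.1) * superFactor (m + 1) ^ k = 1 - R'.1 := by
    rintro m ⟨R, h1, h2⟩
    obtain ⟨k, hk⟩ := mem_natSeries.mp h1 (m + 1)
    obtain ⟨R', g1, g2, g3⟩ := exists_one_sub_mul_superFactor_pow (by omega) k h1 h2 hk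
    exact ⟨k, ⟨R', g1, g2⟩, g3⟩
  choose k next hnext using step
  -- The `m`-th remainder starts at `X^(m+1)`, and its coefficient there is the exponent with index
  -- `m + 1`; this explains the shift `i - 1` in the witness.
  let seq : ∀ m : ℕ, {R : ℚ⟦X⟧ // R ∈ natSeries ∧ X ^ (m + 1) ∣ R} :=
    fun m => Nat.rec ⟨R, hR, by simpa [X_dvd_iff] using h0⟩ next m
  refine ⟨fun i => k (i - 1) (seq (i - 1)), fun N => ?_⟩
  have hprod : ∀ N, (1 - R) * ∏ i ∈ Finset.range N,
      superFactor (i + 1) ^ k (i + 1 - 1) (seq (i + 1 - 1)) = 1 - (seq N).1 := by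
    intro N
    induction N with
    | zero => simp [seq]
    | succ N ih =>
      rw [Finset.prod_range_succ, ← mul_assoc, ih]
      exact hnext N (seq N)
  have hinv : (1 - R) * (1 - R)⁻¹ = 1 := PowerSeries.mul_inv_cancel _ (by simp [h0])
  obtain ⟨S, hS⟩ := (seq N).2.2
  refine ⟨(1 - R)⁻¹ * S, ?_⟩
  have := hprod N
  rw [hS] at this
  linear_combination (-(1 - R)⁻¹) * this +
    (∏ i ∈ Finset.range N, superFactor (i + 1) ^ k (i + 1 - 1) (seq (i + 1 - 1))) * hinv

lemma HasSuperExponents.mul {F G : ℚ⟦X⟧} {v w : ℕ → ℕ} (hF : HasSuperExponents F v)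
    (hG : HasSuperExponents G w) : HasSuperExponents (F * G) (v + w) := by
  intro N
  simp only [Pi.add_apply, pow_add, Finset.prod_mul_distrib]
  obtain ⟨a, ha⟩ := hF N
  obtain ⟨b, hb⟩ := hG N
  exact ⟨a * G + (∏ i ∈ Finset.range N, superFactor (i + 1) ^ v (i + 1)) * b, by
    linear_combination G * ha + (∏ i ∈ Finset.range N, superFactor (i + 1) ^ v (i + 1)) * hb⟩

lemma hasSuperExponents_one : HasSuperExponents 1 0 := by
  intro N
  simp

lemma hasSuperExponents_one_add_X : HasSuperExponents (1 + X) (Pi.single 1 1) := by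
  intro N
  rcases N with _ | N
  · simp
  · rw [Finset.prod_range_succ', Finset.prod_eq_one]
    · simp [superFactor]
    · intro i _
      rw [Pi.single_eq_of_ne (by omega), pow_zero]

/-! ### Clique polynomials -/

section Clique

variable {ι : Type*} [DecidableEq ι] (G : SimpleGraph ι)

open Classical in
/-- The clique polynomial of the subgraph induced on `S`, at `x = -t / (1 + t)`. -/
noncomputable def cliqueSeries (S : Finset ι) : ℚ⟦X⟧ :=
  ∑ T ∈ S.powerset.filter fun T : Finset ι => G.IsClique (T : Set ι), (-X * (1 + X)⁻¹) ^ T.card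

lemma one_add_X_mul_inv : (1 + X : ℚ⟦X⟧) * (1 + X)⁻¹ = 1 :=
  PowerSeries.mul_inv_cancel _ (by simp)

lemma constantCoeff_cliqueSeries (S : Finset ι) : constantCoeff (cliqueSeries G S) = 1 := by
  classical
  rw [cliqueSeries, map_sum, Finset.sum_eq_single ∅]
  · simp
  · intro T _ hT
    simp [hT]
  · simp

lemma cliqueSeries_empty : cliqueSeries G ∅ = 1 := by
  classical
  simp [cliqueSeries, Finset.filter_singleton]

lemma cliqueSeries_mul_inv (S : Finset ι) : cliqueSeries G S * (cliqueSeries G S)⁻¹ = 1 :=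
  PowerSeries.mul_inv_cancel _ (by simp [constantCoeff_cliqueSeries])

-- A clique containing `v` is `v` together with a clique among the neighbours of `v`.
open Classical in
lemma cliqueSeries_insert {S : Finset ι} {v : ι} (hv : v ∉ S) :
    cliqueSeries G (insert v S) =
      cliqueSeries G S + (-X * (1 + X)⁻¹) * cliqueSeries G {w ∈ S | G.Adj v w} := by
  simp only [cliqueSeries, Finset.sum_filter]
  rw [Finset.sum_powerset_insert hv, Finset.mul_sum]
  congr 1
  rw [← Finset.sum_subset (Finset.powerset_mono.mpr (Finset.filter_subset (fun w => G.Adj v w) S))]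
  · refine Finset.sum_congr rfl fun T hT => ?_
    rw [Finset.mem_powerset] at hT
    have hvT : v ∉ T := fun h => hv (Finset.mem_filter.mp (hT h)).1
    have : G.IsClique ((insert v T : Finset ι) : Set ι) ↔ G.IsClique (T : Set ι) := by
      rw [Finset.coe_insert, SimpleGraph.isClique_insert]
      exact ⟨fun h => h.1, fun h => ⟨h, fun b hb _ => (Finset.mem_filter.mp (hT hb)).2⟩⟩
    simp only [this, Finset.card_insert_of_notMem hvT]
    split_ifs
    · ring
    · ring
  · intro T hT hT'
    rw [Finset.mem_powerset] at hT hT'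
    rw [if_neg]
    intro h
    rw [Finset.coe_insert, SimpleGraph.isClique_insert] at h
    refine hT' fun w hw => Finset.mem_filter.mpr ⟨hT hw, h.2 w hw ?_⟩
    rintro rfl
    exact hv (hT hw)

-- Dividing the recursion by `cliqueSeries G S` and multiplying by `1 + X` clears the denominator of
-- `-X/(1+X)` and leaves `1 + X - X * ratio`.
open Classical in
lemma cliqueSeries_insert_inv {S : Finset ι} {v : ι} (hv : v ∉ S) :
    (cliqueSeries G (insert v S))⁻¹ = (cliqueSeries G S)⁻¹ * ((1 + X) *
      (1 - X * (cliqueSeries G {w ∈ S | G.Adj v w} * (cliqueSeries G S)⁻¹ - 1))⁻¹) := by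
  set L := cliqueSeries G {w ∈ S | G.Adj v w}
  have h1 := cliqueSeries_insert G hv
  have h2 := cliqueSeries_mul_inv G S
  have h3 := cliqueSeries_mul_inv G (insert v S)
  have h4 : (1 - X * (L * (cliqueSeries G S)⁻¹ - 1)) *
      (1 - X * (L * (cliqueSeries G S)⁻¹ - 1))⁻¹ = 1 :=
    PowerSeries.mul_inv_cancel _ (by simp)
  have h5 := one_add_X_mul_inv
  have key : cliqueSeries G (insert v S) * ((cliqueSeries G S)⁻¹ * (1 + X)) =
      1 - X * (L * (cliqueSeries G S)⁻¹ - 1) := by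
    rw [h1]
    linear_combination (1 + X) * h2 - X * L * (cliqueSeries G S)⁻¹ * h5
  rw [← key] at h4 ⊢
  set A := cliqueSeries G (insert v S)
  set B := (A * ((cliqueSeries G S)⁻¹ * (1 + X)))⁻¹
  linear_combination (-A⁻¹) * h4 + (cliqueSeries G S)⁻¹ * (1 + X) * B * h3

lemma one_sub_X_mul_ratio {P : ℚ⟦X⟧} (hP : P ∈ natSeries) (h0 : constantCoeff P = 1) :
    X * (P - 1) ∈ natSeries ∧ constantCoeff (X * (P - 1)) = 0 := by
  refine ⟨mul_mem X_mem_natSeries ?_, by simp⟩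
  -- The exponent `0` makes `X ^ m` equal to `1`, so the constant term is what gets removed.
  have := sub_X_pow_mem_natSeries (m := 0) (k := 0) hP (by simpa using h0)
  simpa using this

lemma constantCoeff_ratio (S T : Finset ι) :
    constantCoeff (cliqueSeries G T * (cliqueSeries G S)⁻¹) = 1 := by
  simp [constantCoeff_cliqueSeries]

/-- Deleting a vertex `v` of `S` outside `T` turns the ratio into that of `T` over `S \ {v}` times a
factor built from the ratio of the neighbourhood of `v` over `S \ {v}`. Both are ratios over a
smaller set. -/
lemma ratio_mem_natSeries (S : Finset ι) :
    ∀ T ⊆ S, cliqueSeries G T * (cliqueSeries G S)⁻¹ ∈ natSeries := by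
  classical
  induction S using Finset.strongInduction with
  | H S ih =>
    intro T hT
    by_cases hTS : T = S
    · rw [hTS, cliqueSeries_mul_inv]
      exact one_mem _
    obtain ⟨v, hvS, hvT⟩ := Finset.exists_of_ssubset (hT.ssubset_of_ne hTS)
    have hss : S.erase v ⊂ S := Finset.erase_ssubset hvS
    have hv : v ∉ S.erase v := Finset.notMem_erase v S
    have hr := ih _ hss _ (Finset.filter_subset (fun w => G.Adj v w) _)
    obtain ⟨h1, h2⟩ := one_sub_X_mul_ratio hr (constantCoeff_ratio G _ _)
    rw [← Finset.insert_erase hvS, cliqueSeries_insert_inv G hv, ← mul_assoc]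
    exact mul_mem (ih _ hss T (Finset.subset_erase.mpr ⟨hT, hvT⟩))
      (mul_mem (add_mem (one_mem _) X_mem_natSeries) (inv_one_sub_mem_natSeries h1 h2))

theorem exists_hasSuperExponents_cliqueSeries_inv (S : Finset ι) :
    ∃ v, HasSuperExponents (cliqueSeries G S)⁻¹ v := by
  classical
  induction S using Finset.induction_on with
  | empty => exact ⟨0, by simpa [cliqueSeries_empty] using hasSuperExponents_one⟩
  | insert v S hv ih =>
    obtain ⟨w, hw⟩ := ih
    obtain ⟨h1, h2⟩ := one_sub_X_mul_ratio
      (ratio_mem_natSeries G S _ (Finset.filter_subset (fun w => G.Adj v w) _))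
      (constantCoeff_ratio G _ _)
    obtain ⟨u, hu⟩ := exists_hasSuperExponents_inv_one_sub h1 h2
    rw [cliqueSeries_insert_inv G hv]
    exact ⟨_, hw.mul (hasSuperExponents_one_add_X.mul hu)⟩

end Clique

/-! ### Newton's recursion -/

section Newton

variable {R S : Type*} [CommRing R] [CommRing S]

/-- The power sums computed from the elementary symmetric functions by Newton's identities. -/
noncomputable def newtonRec (s : ℕ → R) (k : ℕ) : R :=
  (-1) ^ (k + 1) * k * s k - ∑ i : Fin k, (-1) ^ (k - i : ℕ) * s (k - i) * newtonRec s i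
termination_by k
decreasing_by exact i.2

/-- The zeroth value is `0` and not the number of variables, so the term `i = 0` of the recursion
vanishes, as Newton's identities require. -/
lemma newtonRec_zero (s : ℕ → R) : newtonRec s 0 = 0 := by
  rw [newtonRec]
  simp

lemma map_newtonRec (φ : R →+* S) (s : ℕ → R) (k : ℕ) :
    φ (newtonRec s k) = newtonRec (fun n => φ (s n)) k := by
  induction k using Nat.strong_induction_on with
  | _ k ih =>
    rw [newtonRec, newtonRec, map_sub, map_sum]
    simp only [map_mul, map_pow, map_neg, map_one, map_natCast]
    congr 1
    exact Finset.sum_congr rfl fun i _ => by rw [ih i i.2]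

lemma newtonRec_congr {s t : ℕ → R} {k : ℕ} (h : ∀ n, 1 ≤ n → n ≤ k → s n = t n) :
    newtonRec s k = newtonRec t k := by
  induction k using Nat.strong_induction_on with
  | _ k ih =>
    rw [newtonRec, newtonRec]
    congr 1
    · rcases Nat.eq_zero_or_pos k with rfl | hk
      · simp
      · rw [h k hk le_rfl]
    · refine Finset.sum_congr rfl fun i _ => ?_
      rw [h (k - i) (by omega) (by omega), ih i i.2 fun n h1 h2 => h n h1 (by omega)]

lemma newtonRec_esymm {σ : Type*} [Fintype σ] {k : ℕ} (hk : 1 ≤ k) :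
    newtonRec (MvPolynomial.esymm σ R) k = MvPolynomial.psum σ R k := by
  induction k using Nat.strong_induction_on with
  | _ k ih =>
    rw [newtonRec, MvPolynomial.psum_eq_mul_esymm_sub_sum σ R k (by omega)]
    congr 1
    rw [Finset.sum_filter, Finset.Nat.sum_antidiagonal_eq_sum_range_succ_mk,
      ← Finset.sum_range_reflect, Finset.sum_range_succ,
      ← Fin.sum_univ_eq_sum_range (fun j => if (k + 1 - 1 - j, k - (k + 1 - 1 - j)).1 ∈
        Set.Ioo 0 k then _ else 0)]
    rw [if_neg (by simp), add_zero]
    refine Finset.sum_congr rfl fun i _ => ?_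
    have hi := i.2
    rcases Nat.eq_zero_or_pos (i : ℕ) with h0 | h0
    · rw [if_neg (by simp [h0]), h0, newtonRec_zero, mul_zero]
    · rw [if_pos (by simp only [Set.mem_Ioo]; omega), ih i hi h0]
      simp only
      rw [show k + 1 - 1 - (i : ℕ) = k - i by omega, show k - (k - (i : ℕ)) = i by omega]

lemma newtonPoly_eq (d : ℕ) : newtonPoly d = newtonRec
    (fun n => if h : n - 1 < d then MvPolynomial.X (⟨n - 1, h⟩ : Fin d) else 0) d := by
  rw [newtonPoly, AlgEquiv.symm_apply_eq]
  apply Subtype.ext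
  rw [MvPolynomial.esymmAlgEquiv_apply, MvPolynomial.esymmAlgHom_apply]
  rcases Nat.eq_zero_or_pos d with rfl | hd
  · simp [newtonRec_zero, MvPolynomial.psum]
  · have := map_newtonRec (MvPolynomial.aeval (R := ℤ)
      (fun i : Fin d => MvPolynomial.esymm (Fin d) ℤ (i + 1))).toRingHom
      (fun n => if h : n - 1 < d then MvPolynomial.X (⟨n - 1, h⟩ : Fin d) else 0) d
    refine Eq.trans ?_ this.symm
    refine (newtonRec_esymm (R := ℤ) (σ := Fin d) hd).symm.trans ?_
    -- Only the indices `1 ≤ n ≤ d` matter; the values at `n = 0`, where `n - 1` truncates, and at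
    -- `n > d` are immaterial.
    refine newtonRec_congr fun n h1 h2 => ?_
    rw [dif_pos (by omega)]
    simp [Nat.sub_add_cancel h1]

lemma newton_eq_newtonRec (s : ℕ → R) (d : ℕ) : newton s d = newtonRec s d := by
  rw [newton, newtonPoly_eq]
  refine (map_newtonRec (MvPolynomial.aeval (R := ℤ)
      (fun i : Fin d => s (i + 1))).toRingHom _ d).trans ?_
  refine newtonRec_congr fun n h1 h2 => ?_
  rw [dif_pos (by omega)]
  simp [Nat.sub_add_cancel h1]

/-- Newton's identities as a generating function: formally `T = ∏ (1 - γ X)`, and `-X T'/T = ∑ p_d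
X^d`. -/
lemma mk_newtonRec_mul {s : ℕ → R} {T : R⟦X⟧} (h0 : coeff 0 T = 1)
    (hT : ∀ n, 1 ≤ n → coeff n T = (-1) ^ n * s n) :
    PowerSeries.mk (newtonRec s) * T = -(X * derivative R T) := by
  ext k
  rw [coeff_mul, map_neg, Finset.Nat.sum_antidiagonal_eq_sum_range_succ_mk,
    Finset.sum_range_succ]
  have hX : coeff k (X * derivative R T) = k * coeff k T := by
    rcases k with _ | k
    · simp
    · rw [coeff_succ_X_mul, coeff_derivative]
      push_cast
      ring
  simp only [coeff_mk, Nat.sub_self, h0, mul_one, hX]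
  rcases Nat.eq_zero_or_pos k with rfl | hk
  · simp [newtonRec_zero]
  · rw [hT k hk, newtonRec, ← Fin.sum_univ_eq_sum_range (fun i => newtonRec s i * coeff (k - i) T)]
    have : ∑ i : Fin k, newtonRec s i * coeff (k - i) T =
        ∑ i : Fin k, (-1) ^ (k - i : ℕ) * s (k - i) * newtonRec s i :=
      Finset.sum_congr rfl fun i _ => by rw [hT _ (by omega)]; ring
    rw [this]
    ring

end Newton

lemma mk_newtonRec_inv_mul {s : ℕ → ℚ} {Q : ℚ⟦X⟧} (h0 : constantCoeff Q = 1)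
    (hs : ∀ n, 1 ≤ n → coeff n Q⁻¹ = (-1) ^ n * s n) :
    PowerSeries.mk (newtonRec s) * Q = X * derivative ℚ Q := by
  have h1 := mk_newtonRec_mul (T := Q⁻¹) (by simp [h0]) hs
  have h2 : Q * Q⁻¹ = 1 := PowerSeries.mul_inv_cancel _ (by simp [h0])
  have h3 : Q * derivative ℚ Q⁻¹ + Q⁻¹ * derivative ℚ Q = 0 := by
    have := congrArg (derivative ℚ) h2
    simpa [Derivation.leibniz] using this
  linear_combination Q ^ 2 * h1 - (PowerSeries.mk (newtonRec s) * Q - X * derivative ℚ Q) * h2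
    - Q * X * h3

/-- For the sequence of coefficients of `Q` the role of `T` is played by `Q(-X)`. Its power sum
series, evaluated at `-X`, is therefore `-X Q'/Q`, the negative of the series for `s`. -/
lemma newtonRec_coeff_eq {s : ℕ → ℚ} {Q : ℚ⟦X⟧} (h0 : constantCoeff Q = 1)
    (hs : ∀ n, 1 ≤ n → coeff n Q⁻¹ = (-1) ^ n * s n) (d : ℕ) :
    newtonRec (fun n => coeff n Q) d = -(-1) ^ d * newtonRec s d := by
  have h1 := mk_newtonRec_inv_mul h0 hs
  have h2 : rescale (-1) (PowerSeries.mk (newtonRec fun n => coeff n Q)) * Q =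
      -(X * derivative ℚ Q) := by
    have := congrArg (rescale (-1 : ℚ)) (mk_newtonRec_mul (s := fun n => coeff n Q)
      (T := rescale (-1) Q) (by simp [h0]) fun n _ => coeff_rescale _ _ _)
    rw [map_mul, rescale_rescale] at this
    norm_num at this
    rw [this]
    ext (_ | n)
    · simp
    · rw [map_neg, coeff_succ_X_mul, coeff_succ_X_mul, coeff_rescale, coeff_derivative,
        coeff_derivative, coeff_rescale, ← mul_assoc, ← mul_assoc, ← pow_add,
        Odd.neg_one_pow ⟨n, by ring⟩]
      ring
  have hQ : Q ≠ 0 := by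
    rintro rfl
    simp at h0
  have h3 : rescale (-1) (PowerSeries.mk (newtonRec fun n => coeff n Q)) =
      -PowerSeries.mk (newtonRec s) :=
    mul_right_cancel₀ hQ (by rw [h2, neg_mul, h1])
  have h4 := congrArg (coeff d) h3
  rw [coeff_rescale, coeff_mk, map_neg, coeff_mk] at h4
  have h5 : ((-1 : ℚ) ^ d) * (-1) ^ d = 1 := by rw [← mul_pow]; simp
  linear_combination (-1) ^ d * h4 - newtonRec (fun n => coeff n Q) d * h5

/-! ### Logarithmic derivatives -/

/-- The logarithmic derivative (multiplied by `X`) of `superFactor m`. -/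
noncomputable def logSuperFactor (m : ℕ) : ℚ⟦X⟧ :=
  PowerSeries.mk fun n => if m ∣ n ∧ n ≠ 0 then (-1) ^ (m + n) * (m : ℚ) else 0

/-- The closed form `m X^m / (1 - (-1)^m X^m)` treats both parities at once. -/
lemma logSuperFactor_mul {m : ℕ} (hm : 1 ≤ m) :
    logSuperFactor m * (1 - (-1) ^ m * X ^ m) = (m : ℚ⟦X⟧) * X ^ m := by
  have hC : ((-1) ^ m * X ^ m : ℚ⟦X⟧) = C ((-1 : ℚ) ^ m) * X ^ m := by simp
  have hC' : ((m : ℚ⟦X⟧) * X ^ m) = C (m : ℚ) * X ^ m := by simp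
  ext n
  rw [mul_sub, mul_one, hC, hC', mul_left_comm, map_sub, coeff_C_mul, coeff_C_mul, coeff_X_pow,
    coeff_mul_X_pow', logSuperFactor, coeff_mk]
  rcases lt_trichotomy n m with h | rfl | h
  · rw [if_neg, if_neg h.not_ge, if_neg h.ne]
    · ring
    · rintro ⟨h1, h2⟩
      exact h2 (Nat.eq_zero_of_dvd_of_lt h1 h)
  · rw [if_pos ⟨dvd_rfl, by omega⟩, if_pos le_rfl, if_pos rfl, coeff_mk, if_neg (by simp),
      Even.neg_one_pow ⟨n, rfl⟩]
    ring
  · rw [if_pos h.le, if_neg h.ne', coeff_mk]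
    by_cases hd : m ∣ n
    · rw [if_pos ⟨hd, by omega⟩, if_pos ⟨Nat.dvd_sub hd dvd_rfl, by omega⟩,
        show m + (n - m) = n by omega, pow_add]
      ring
    · rw [if_neg (fun h => hd h.1), if_neg]
      · ring
      · rintro ⟨h1, -⟩
        exact hd ((Nat.dvd_sub_iff_left h.le dvd_rfl).mp h1)

lemma X_mul_derivative_superFactor {m : ℕ} (hm : 1 ≤ m) :
    X * derivative ℚ (superFactor m) = superFactor m * logSuperFactor m := by
  have hl := logSuperFactor_mul hm
  have hX : X * derivative ℚ (X ^ m : ℚ⟦X⟧) = (m : ℚ⟦X⟧) * X ^ m := by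
    obtain ⟨k, rfl⟩ : ∃ k, m = k + 1 := ⟨m - 1, by omega⟩
    rw [Derivation.leibniz_pow]
    simp only [Nat.add_sub_cancel, derivative_X, smul_eq_mul, nsmul_eq_mul]
    ring
  unfold superFactor
  split_ifs with h
  · rw [h.neg_one_pow] at hl
    rw [map_add, ← map_one (C (R := ℚ)), derivative_C, map_one]
    linear_combination hX - hl
  · rw [(Nat.not_odd_iff_even.mp h).neg_one_pow] at hl
    have h1 := one_sub_X_pow_mul_inv hm
    set E := (1 - X ^ m : ℚ⟦X⟧)⁻¹
    have h2 : (1 - X ^ m) * derivative ℚ E - E * derivative ℚ (X ^ m) = 0 := by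
      have := congrArg (derivative ℚ) h1
      rw [Derivation.leibniz, map_sub, ← map_one (C (R := ℚ)), derivative_C, map_one] at this
      simp only [smul_eq_mul] at this
      linear_combination this
    linear_combination X * E * h2 + E ^ 2 * hX - E ^ 2 * hl -
      (X * derivative ℚ E - E * logSuperFactor m) * h1

lemma X_mul_derivative_prod_superFactor (v : ℕ → ℕ) (N : ℕ) :
    X * derivative ℚ (∏ i ∈ Finset.range N, superFactor (i + 1) ^ v (i + 1)) =
      (∏ i ∈ Finset.range N, superFactor (i + 1) ^ v (i + 1)) *
        ∑ i ∈ Finset.range N, (v (i + 1) : ℚ⟦X⟧) * logSuperFactor (i + 1) := by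
  have hpow : ∀ (m k : ℕ), 1 ≤ m → X * derivative ℚ (superFactor m ^ k) =
      superFactor m ^ k * ((k : ℚ⟦X⟧) * logSuperFactor m) := by
    intro m k hm
    have h := X_mul_derivative_superFactor hm
    induction k with
    | zero => simp
    | succ k ih =>
      rw [pow_succ, Derivation.leibniz]
      simp only [smul_eq_mul]
      push_cast
      linear_combination superFactor m * ih + superFactor m ^ k * h
  induction N with
  | zero => simp
  | succ N ih =>
    rw [Finset.prod_range_succ, Finset.sum_range_succ, Derivation.leibniz]
    simp only [smul_eq_mul]
    linear_combination superFactor (N + 1) ^ v (N + 1) * ih +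
      (∏ i ∈ Finset.range N, superFactor (i + 1) ^ v (i + 1)) * hpow (N + 1) _ (by omega)

lemma coeff_of_hasSuperExponents {Q P : ℚ⟦X⟧} {v : ℕ → ℕ} (h0 : constantCoeff Q = 1)
    (hv : HasSuperExponents Q v) (hP : P * Q = X * derivative ℚ Q) {N : ℕ} (hN : 1 ≤ N) :
    (-1) ^ N * coeff N P = ∑ i ∈ N.divisors, (-1) ^ i * (i : ℚ) * v i := by
  obtain ⟨U, hU⟩ := hv N
  set P' := ∏ i ∈ Finset.range N, superFactor (i + 1) ^ v (i + 1) with hPr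
  set L := ∑ i ∈ Finset.range N, (v (i + 1) : ℚ⟦X⟧) * logSuperFactor (i + 1) with hL
  have hPL : X * derivative ℚ P' = P' * L := X_mul_derivative_prod_superFactor v N
  -- Differentiating the error `X^(N+1) U` loses one power of `X`; the factor `X` in front of the
  -- derivative restores it.
  have hdvd : X ^ (N + 1) ∣ P - L := by
    have h2 : Q * Q⁻¹ = 1 := PowerSeries.mul_inv_cancel _ (by simp [h0])
    have h3 : derivative ℚ Q - derivative ℚ P' =
        X ^ (N + 1) * derivative ℚ U + U * (((N + 1 : ℕ) : ℚ⟦X⟧) * X ^ N) := by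
      rw [← map_sub, hU, Derivation.leibniz, Derivation.leibniz_pow]
      simp
    refine ⟨Q⁻¹ * (X * derivative ℚ U + U * ((N + 1 : ℕ) : ℚ⟦X⟧) - U * L), ?_⟩
    linear_combination Q⁻¹ * hP + Q⁻¹ * hPL + Q⁻¹ * X * h3 - Q⁻¹ * L * hU - (P - L) * h2
  have hc : coeff N P = coeff N L := by
    have := X_pow_dvd_iff.mp hdvd N (by omega)
    rwa [map_sub, sub_eq_zero] at this
  have hterm : ∀ i, coeff N ((v (i + 1) : ℚ⟦X⟧) * logSuperFactor (i + 1)) =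
      if i + 1 ∣ N then (-1) ^ (i + 1 + N) * ((i + 1 : ℕ) : ℚ) * v (i + 1) else 0 := by
    intro i
    rw [← map_natCast (C (R := ℚ)), coeff_C_mul, logSuperFactor, coeff_mk]
    by_cases h : i + 1 ∣ N
    · rw [if_pos ⟨h, by omega⟩, if_pos h]
      ring
    · rw [if_neg (fun h' => h h'.1), if_neg h, mul_zero]
  rw [hc, hL, map_sum, Finset.sum_congr rfl fun i _ => hterm i, Nat.divisors,
    Finset.sum_filter, Finset.sum_Ico_eq_sum_range, Finset.mul_sum]
  refine Finset.sum_congr (by simp) fun i _ => ?_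
  rw [add_comm 1 i]
  split_ifs
  · have h5 : ((-1 : ℚ) ^ N) * (-1) ^ N = 1 := by rw [← mul_pow]; simp
    rw [pow_add _ (i + 1) N]
    linear_combination (-1) ^ (i + 1) * ((i + 1 : ℕ) : ℚ) * v (i + 1) * h5
  · simp

/-- Möbius inversion is applied to `d ↦ (-1)^d p d`; the outer sign cancels the one in `(-1)^N * N *
v N`. -/
lemma moebius_sum_eq {R : Type*} [CommRing R] {p : ℕ → R} {v : ℕ → ℕ}
    (h : ∀ N, 1 ≤ N → (-1) ^ N * p N = ∑ i ∈ N.divisors, (-1) ^ i * (i : R) * v i)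
    {N : ℕ} (hN : 1 ≤ N) :
    (-1) ^ N * ∑ d ∈ N.divisors, (ArithmeticFunction.moebius (N / d) : R) * (-1) ^ d * p d =
      N * v N := by
  have h1 := ArithmeticFunction.sum_eq_iff_sum_mul_moebius_eq.mp (fun n hn => (h n hn).symm) N hN
  rw [Nat.sum_divisorsAntidiagonal'
    (f := fun a b => (ArithmeticFunction.moebius a : R) * ((-1) ^ b * p b))] at h1
  simp only [← mul_assoc] at h1
  rw [h1, ← mul_assoc, ← mul_assoc, ← mul_pow]
  simp

/-! ### Flag complexes, their 1-skeleta and the series `Q` -/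

section Complex

variable {ι : Type*} (K : AbstractSimplicialComplex ι)

/-- The 1-skeleton of `K`. -/
def skeletonGraph [DecidableEq ι] : SimpleGraph ι where
  Adj a b := a ≠ b ∧ ({a, b} : Finset ι) ∈ K
  symm := ⟨fun a b h => ⟨h.1.symm, by rw [Finset.pair_comm]; exact h.2⟩⟩
  loopless := ⟨fun _ h => h.1 rfl⟩

variable {K}

lemma mem_of_subset {s t : Finset ι} (hs : s ∈ K) (hts : t ⊆ s) (ht : t.Nonempty) : t ∈ K :=
  (K.isRelLowerSet_faces hs).2 hts ht

/-- For the converse, a clique outside `K` that is minimal under inclusion would be a minimal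
non-face, hence a pair; but a pair that is a clique is an edge of `K`. -/
lemma IsFlag.mem_iff [DecidableEq ι] (hK : IsFlag K) {s : Finset ι} (hs : s.Nonempty) :
    s ∈ K ↔ (skeletonGraph K).IsClique (s : Set ι) := by
  constructor
  · intro h a ha b hb hab
    refine ⟨hab, mem_of_subset h ?_ (Finset.insert_nonempty _ _)⟩
    intro x hx
    rw [Finset.mem_insert, Finset.mem_singleton] at hx
    rcases hx with rfl | rfl <;> assumption
  · induction s using Finset.strongInduction with
    | H s ih =>
      intro h
      by_contra hsK
      have hmin : IsMinimalNonface K s := ⟨hs, hsK, fun t ht hne =>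
        ih t ht hne (h.subset (by exact_mod_cast ht.1))⟩
      obtain ⟨a, b, hab, rfl⟩ := Finset.card_eq_two.mp (hK s hmin)
      exact hsK (h (by simp) (by simp) hab).2

variable [Fintype ι]

open Classical in
lemma IsFlag.faceNumber_eq [DecidableEq ι] (hK : IsFlag K) (i : ℕ) : faceNumber K i =
    (((Finset.univ : Finset ι).powerset.filter fun T : Finset ι =>
      (skeletonGraph K).IsClique (T : Set ι)).filter fun T => T.card = i + 1).card := by
  rw [faceNumber, ← Set.ncard_coe_finset]
  congr 1
  ext s
  simp only [Set.mem_ofPred_eq, Finset.coe_filter, Finset.mem_filter, Finset.mem_powerset,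
    Finset.subset_univ, true_and]
  refine and_congr_left fun h => hK.mem_iff (Finset.card_pos.mp (by omega))

lemma faceNumber_eq_zero (K : AbstractSimplicialComplex ι) {i : ℕ} (hi : Fintype.card ι ≤ i) :
    faceNumber K i = 0 := by
  rw [faceNumber, Set.ncard_eq_zero (Set.toFinite _), Set.eq_empty_iff_forall_notMem]
  rintro s ⟨-, hs⟩
  have := s.card_le_univ
  omega

lemma X_pow_mul_one_add_X_inv (k : ℕ) :
    (X ^ k * ((1 + X) ^ k)⁻¹ : ℚ⟦X⟧) = (-1) ^ k * (-X * (1 + X)⁻¹) ^ k := by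
  have h : ((1 + X : ℚ⟦X⟧) ^ k)⁻¹ = ((1 + X)⁻¹) ^ k := by
    rw [PowerSeries.inv_eq_iff_mul_eq_one (by simp), ← mul_pow, mul_comm, one_add_X_mul_inv,
      one_pow]
  rw [h, ← mul_pow, ← mul_pow]
  ring

/-- Cliques are grouped by cardinality; the empty clique accounts for the summand `1`, and the signs
are absorbed in the powers of `-X/(1+X)`. -/
theorem IsFlag.flagSeries_eq [DecidableEq ι] (hK : IsFlag K) :
    flagSeries K = (cliqueSeries (skeletonGraph K) Finset.univ)⁻¹ := by
  classical
  rw [flagSeries, cliqueSeries]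
  congr 1
  set F := (Finset.univ : Finset ι).powerset.filter fun T : Finset ι =>
      (skeletonGraph K).IsClique (T : Set ι) with hF
  rw [← Finset.sum_fiberwise_of_maps_to (t := Finset.range (Fintype.card ι + 1))
    (g := Finset.card) fun T _ => Finset.mem_range.mpr (Nat.lt_succ_of_le T.card_le_univ),
    Finset.sum_range_succ', add_comm]
  congr 1
  · refine Finset.sum_congr rfl fun i _ => ?_
    rw [Finset.sum_congr rfl fun T hT => by rw [(Finset.mem_filter.mp hT).2], Finset.sum_const,
      ← hK.faceNumber_eq, X_pow_mul_one_add_X_inv, nsmul_eq_mul]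
    have h1 : (C ((-1 : ℚ) ^ (i + 1) * (faceNumber K i : ℚ)) : ℚ⟦X⟧) =
        (-1) ^ (i + 1) * (faceNumber K i : ℚ⟦X⟧) := by simp
    have h2 : ((-1 : ℚ⟦X⟧) ^ (i + 1)) * (-1) ^ (i + 1) = 1 := by rw [← mul_pow]; simp
    rw [h1]
    linear_combination (faceNumber K i : ℚ⟦X⟧) * (-X * (1 + X)⁻¹) ^ (i + 1) * h2
  · rw [Finset.sum_eq_single ∅]
    · simp
    · intro T hT hne
      simp only [Finset.mem_filter, Finset.card_eq_zero] at hT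
      exact absurd hT.2 hne
    · simp [hF]

lemma one_add_X_pow_inv (i : ℕ) : ((1 + X : ℚ⟦X⟧) ^ (i + 1))⁻¹ =
    PowerSeries.mk fun n => (-1) ^ n * ((i + n).choose i : ℚ) := by
  rw [PowerSeries.inv_eq_iff_mul_eq_one (by simp)]
  have := congrArg (rescale (-1 : ℚ)) (mk_add_choose_mul_one_sub_pow_eq_one ℚ i)
  simpa [rescale_mk, rescale_neg_one_X] using this

lemma coeff_X_pow_mul_one_add_X_inv {n : ℕ} (hn : 1 ≤ n) (i : ℕ) :
    coeff n (X ^ (i + 1) * ((1 + X : ℚ⟦X⟧) ^ (i + 1))⁻¹) =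
      (-1) ^ (n + i + 1) * ((n - 1).choose i : ℚ) := by
  rw [one_add_X_pow_inv, coeff_X_pow_mul', coeff_mk]
  split_ifs with h
  · obtain ⟨k, rfl⟩ := Nat.exists_eq_add_of_le h
    rw [show i + 1 + k - (i + 1) = k by omega, show i + 1 + k - 1 = i + k by omega,
      show i + 1 + k + i + 1 = 2 * (i + 1) + k by ring, pow_add, pow_mul]
    norm_num
  · rw [Nat.choose_eq_zero_of_lt (by omega)]
    simp

lemma coeff_flagSeries_inv (K : AbstractSimplicialComplex ι) {n : ℕ} (hn : 1 ≤ n) :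
    coeff n (flagSeries K)⁻¹ = (-1) ^ n * (alpha K n : ℚ) := by
  have h1 : (flagSeries K)⁻¹ = 1 + ∑ i ∈ Finset.range (Fintype.card ι),
      C ((-1 : ℚ) ^ (i + 1) * (faceNumber K i : ℚ)) *
        (X ^ (i + 1) * ((1 + X) ^ (i + 1))⁻¹) := by
    rw [flagSeries, PowerSeries.inv_eq_iff_mul_eq_one, PowerSeries.mul_inv_cancel]
    · simp
    · simp
  rw [h1, map_add, coeff_one, if_neg (by omega), zero_add, map_sum]
  simp only [coeff_C_mul, coeff_X_pow_mul_one_add_X_inv hn]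
  rw [alpha]
  push_cast
  rw [Finset.mul_sum]
  have hterm : ∀ i, (-1 : ℚ) ^ (i + 1) * (faceNumber K i : ℚ) *
      ((-1) ^ (n + i + 1) * ((n - 1).choose i : ℚ)) =
      (-1) ^ n * ((faceNumber K i : ℚ) * ((n - 1).choose i : ℚ)) := by
    intro i
    have h2 : ((-1 : ℚ) ^ (i + 1)) * (-1) ^ (i + 1) = 1 := by rw [← mul_pow]; simp
    rw [add_assoc n i 1, pow_add _ n]
    linear_combination (-1) ^ n * ((faceNumber K i : ℚ) * ((n - 1).choose i : ℚ)) * h2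
  rw [Finset.sum_congr rfl fun i _ => hterm i]
  -- Both index ranges are compared with their maximum: past `Fintype.card ι` the face numbers
  -- vanish, past `n` the binomial coefficients do.
  rw [Finset.sum_subset (Finset.range_mono (le_max_left (Fintype.card ι) n)),
    ← Finset.sum_subset (Finset.range_mono (le_max_right (Fintype.card ι) n))]
  · intro i _ hi
    rw [Nat.choose_eq_zero_of_lt (by rw [Finset.mem_range] at hi; omega)]
    simp
  · intro i _ hi
    rw [faceNumber_eq_zero K (by rw [Finset.mem_range] at hi; omega)]
    simp

lemma constantCoeff_flagSeries (hK : IsFlag K) : constantCoeff (flagSeries K) = 1 := by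
  classical
  simp [hK.flagSeries_eq, constantCoeff_cliqueSeries]

theorem IsFlag.exists_superExponents (hK : IsFlag K) :
    ∃ v : ℕ → ℕ, HasSuperExponents (flagSeries K) v ∧ ∀ N : ℕ, 1 ≤ N →
      (-1 : ℤ) ^ N * ∑ d ∈ N.divisors, ArithmeticFunction.moebius (N / d) * (-1) ^ d *
        newton (alpha K) d = (N : ℤ) * (v N : ℤ) := by
  classical
  obtain ⟨v, hv⟩ := exists_hasSuperExponents_cliqueSeries_inv (skeletonGraph K) Finset.univ
  rw [← hK.flagSeries_eq] at hv
  refine ⟨v, hv, fun N hN => ?_⟩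
  have h0 := constantCoeff_flagSeries hK
  have hP := mk_newtonRec_inv_mul h0 (s := fun n => (alpha K n : ℚ))
    fun n hn => coeff_flagSeries_inv K hn
  have hc := moebius_sum_eq (p := newtonRec fun n => (alpha K n : ℚ)) (v := v) (fun N hN => by
    rw [← coeff_of_hasSuperExponents h0 hv hP hN, coeff_mk]) hN
  have hcast : ∀ d, newtonRec (fun n => (alpha K n : ℚ)) d = (newton (alpha K) d : ℤ) := by
    intro d
    rw [newton_eq_newtonRec]
    exact (map_newtonRec (Int.castRingHom ℚ) (alpha K) d).symm
  simp only [hcast] at hc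
  exact_mod_cast hc

theorem newton_coeff_flagSeries (hK : IsFlag K) (d : ℕ) :
    newton (fun n => coeff n (flagSeries K)) d = -(-1) ^ d * (newton (alpha K) d : ℤ) := by
  rw [newton_eq_newtonRec, newton_eq_newtonRec, newtonRec_coeff_eq (constantCoeff_flagSeries hK)
    fun n hn => coeff_flagSeries_inv K hn]
  congr 1
  exact (map_newtonRec (Int.castRingHom ℚ) (alpha K) d).symm

/-! ### The inequality for `f_2` -/

lemma two_mul_choose_two (n : ℕ) : 2 * (n.choose 2 : ℤ) = n * (n - 1) := by
  induction n with
  | zero => simp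
  | succ n ih =>
    rw [Nat.choose_succ_succ' n 1, Nat.choose_one_right]
    push_cast
    linear_combination ih

lemma six_mul_choose_three (n : ℕ) : 6 * (n.choose 3 : ℤ) = n * (n - 1) * (n - 2) := by
  induction n with
  | zero => simp
  | succ n ih =>
    rw [Nat.choose_succ_succ' n 2]
    push_cast
    linear_combination ih + 3 * two_mul_choose_two n

lemma newton_one {R : Type*} [CommRing R] (s : ℕ → R) : newton s 1 = s 1 := by
  rw [newton_eq_newtonRec, newtonRec]
  simp [newtonRec_zero]

lemma newton_three {R : Type*} [CommRing R] (s : ℕ → R) :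
    newton s 3 = s 1 ^ 3 - 3 * s 1 * s 2 + 3 * s 3 := by
  have h2 : newtonRec s 2 = s 1 ^ 2 - 2 * s 2 := by
    rw [newtonRec]
    simp only [Fin.sum_univ_two, Fin.val_zero, Fin.val_one, newtonRec_zero]
    rw [← newton_eq_newtonRec, newton_one]
    norm_num
    ring
  rw [newton_eq_newtonRec, newtonRec]
  simp only [Fin.sum_univ_three, Fin.val_zero, Fin.val_one, Fin.val_two, newtonRec_zero, h2]
  rw [← newton_eq_newtonRec, newton_one]
  norm_num
  ring

-- The hypothesis says `p_3 - p_1 ≥ 0` at `α_1 = f_0`, `α_2 = f_0 + f_1`, `α_3 = f_0 + 2 f_1 + f_2`;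
-- this is three times the difference of the two sides of the conclusion.
omit [Fintype ι] in
lemma faceNumber_two_ineq (K : AbstractSimplicialComplex ι)
    (h : 0 ≤ (-1 : ℤ) ^ 3 * ∑ d ∈ Nat.divisors 3, ArithmeticFunction.moebius (3 / d) * (-1) ^ d *
        newton (alpha K) d) :
    ((faceNumber K 0).choose 3 : ℤ) - ((faceNumber K 0 : ℤ) - 2) *
      (((faceNumber K 0).choose 2 : ℤ) - (faceNumber K 1 : ℤ)) ≤ (faceNumber K 2 : ℤ) := by
  rw [Nat.Prime.divisors Nat.prime_three, Finset.sum_pair (by norm_num), newton_one, newton_three,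
    Nat.div_one, Nat.div_self (by norm_num), ArithmeticFunction.moebius_apply_prime Nat.prime_three,
    ArithmeticFunction.moebius_apply_one] at h
  simp only [alpha, Finset.sum_range_succ, Finset.sum_range_zero] at h
  norm_num [Nat.choose] at h
  have h2 := two_mul_choose_two (faceNumber K 0)
  have h3 := six_mul_choose_three (faceNumber K 0)
  nlinarith [h, h2, h3]

end Complex

/-! ### Counting monomials by weight -/

section Counting

variable {E O : Type*}

/-- The exponent vectors supported on `s` of weight `n`, where `e` has weight `d e`. -/
noncomputable def exponentsOfWeight (s : Finset E) (d : E → ℕ) (n : ℕ) : Finset (E →₀ ℕ) :=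
  (s.finsupp fun _ => Finset.range (n + 1)).filter fun a => ∑ e ∈ s, a e * d e = n

/-- As all weights are positive, no exponent exceeds `n`, so the cutoff in the definition excludes
nothing. -/
lemma mem_exponentsOfWeight {s : Finset E} {d : E → ℕ} (hd : ∀ e ∈ s, 1 ≤ d e) {n : ℕ}
    {a : E →₀ ℕ} :
    a ∈ exponentsOfWeight s d n ↔ a.support ⊆ s ∧ ∑ e ∈ s, a e * d e = n := by
  rw [exponentsOfWeight, Finset.mem_filter, Finset.mem_finsupp_iff]
  refine ⟨fun h => ⟨h.1.1, h.2⟩, fun h => ⟨⟨h.1, fun e he => ?_⟩, h.2⟩⟩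
  rw [Finset.mem_range, Nat.lt_succ_iff, ← h.2]
  exact (Nat.le_mul_of_pos_right _ (hd e he)).trans
    (Finset.single_le_sum (f := fun e => a e * d e) (fun _ _ => Nat.zero_le _) he)

lemma one_sub_X_pow_inv {m : ℕ} (hm : 1 ≤ m) :
    (1 - X ^ m : ℚ⟦X⟧)⁻¹ = PowerSeries.mk fun n => if m ∣ n then 1 else 0 := by
  rw [PowerSeries.inv_eq_iff_mul_eq_one
    (by rw [constantCoeff_one_sub_X_pow hm]; exact one_ne_zero)]
  ext n
  rw [mul_sub, mul_one, map_sub, coeff_mk, coeff_mul_X_pow', coeff_one]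
  rcases Nat.lt_or_ge n m with h | h
  · rw [if_neg h.not_ge, sub_zero]
    refine if_congr ⟨fun h' => Nat.eq_zero_of_dvd_of_lt h' h, ?_⟩ rfl rfl
    rintro rfl
    exact dvd_zero _
  · rw [if_pos h, coeff_mk, if_neg (show n ≠ 0 by omega), if_congr
      (Nat.dvd_sub_iff_left h dvd_rfl) rfl rfl, sub_self]

lemma coeff_prod_one_sub_X_pow_inv [DecidableEq E] (s : Finset E) {d : E → ℕ} (hd : ∀ e ∈ s, 1 ≤ d e) (n : ℕ) :
    coeff n (∏ e ∈ s, (1 - X ^ d e : ℚ⟦X⟧)⁻¹) = (exponentsOfWeight s d n).card := by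
  rw [Finset.prod_congr rfl fun e he => one_sub_X_pow_inv (hd e he), coeff_prod]
  simp only [coeff_mk, Finset.prod_boole]
  rw [Finset.sum_boole]
  congr 1
  -- A splitting of `n` into multiples of the `d e` corresponds to the vector of quotients by `d e`.
  refine Finset.card_bij'
    (fun l _ => Finsupp.onFinset l.support (fun e => l e / d e) fun e he => by
      rw [Finsupp.mem_support_iff]; intro h; rw [h, Nat.zero_div] at he; exact he rfl)
    (fun a _ => Finsupp.onFinset a.support (fun e => a e * d e) fun e he => by
      rw [Finsupp.mem_support_iff]; intro h; rw [h, Nat.zero_mul] at he; exact he rfl)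
    ?_ ?_ ?_ ?_
  · intro l hl
    rw [Finset.mem_filter, Finset.mem_finsuppAntidiag] at hl
    rw [mem_exponentsOfWeight hd]
    refine ⟨Finsupp.support_onFinset_subset.trans hl.1.2, ?_⟩
    rw [← hl.1.1]
    exact Finset.sum_congr rfl fun e he => Nat.div_mul_cancel (hl.2 e he)
  · intro a ha
    rw [mem_exponentsOfWeight hd] at ha
    rw [Finset.mem_filter, Finset.mem_finsuppAntidiag]
    exact ⟨⟨ha.2, Finsupp.support_onFinset_subset.trans ha.1⟩, fun e _ => Dvd.intro_left _ rfl⟩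
  · intro l hl
    rw [Finset.mem_filter, Finset.mem_finsuppAntidiag] at hl
    ext e
    simp only [Finsupp.onFinset_apply]
    by_cases he : e ∈ s
    · exact Nat.div_mul_cancel (hl.2 e he)
    · rw [Finsupp.notMem_support_iff.mp fun h => he (hl.1.2 h)]
      simp
  · intro a ha
    rw [mem_exponentsOfWeight hd] at ha
    ext e
    simp only [Finsupp.onFinset_apply]
    by_cases he : e ∈ s
    · exact Nat.mul_div_cancel _ (hd e he)
    · rw [Finsupp.notMem_support_iff.mp fun h => he (ha.1 h)]
      simp

lemma coeff_prod_one_add_X_pow (s : Finset O) (d : O → ℕ) (n : ℕ) :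
    coeff n (∏ o ∈ s, (1 + X ^ d o : ℚ⟦X⟧)) =
      (s.powerset.filter fun S => ∑ o ∈ S, d o = n).card := by
  rw [Finset.prod_one_add, map_sum]
  simp only [Finset.prod_pow_eq_pow_sum, coeff_X_pow]
  rw [Finset.sum_boole]
  simp only [eq_comm]

/-- Each power is spread over `v i` individual generators, so that coefficients count monomials in
them. -/
lemma prod_superFactor_range_two_mul (v : ℕ → ℕ) (M : ℕ) :
    ∏ i ∈ Finset.range (2 * M), superFactor (i + 1) ^ v (i + 1) =
      (∏ e ∈ (Finset.range M).sigma fun j => (Finset.univ : Finset (Fin (v (2 * j + 2)))),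
        (1 - X ^ (2 * e.1 + 2))⁻¹) *
      ∏ o ∈ (Finset.range M).sigma fun j => (Finset.univ : Finset (Fin (v (2 * j + 1)))),
        (1 + X ^ (2 * o.1 + 1)) := by
  rw [Finset.prod_sigma, Finset.prod_sigma]
  simp only [Finset.prod_const, Finset.card_univ, Fintype.card_fin]
  induction M with
  | zero => simp
  | succ M ih =>
    rw [show 2 * (M + 1) = 2 * M + 1 + 1 by ring, Finset.prod_range_succ, Finset.prod_range_succ,
      Finset.prod_range_succ, Finset.prod_range_succ, ih]
    have h1 : superFactor (2 * M + 1) = 1 + X ^ (2 * M + 1) := if_pos ⟨M, rfl⟩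
    have h2 : superFactor (2 * M + 1 + 1) = (1 - X ^ (2 * M + 2))⁻¹ :=
      if_neg (Nat.not_odd_iff_even.mpr ⟨M + 1, by ring⟩)
    rw [h1, h2]
    ring

/-- The weight of a monomial in even and odd generators. -/
noncomputable def monomialWeight {η : ℕ → Type*}
    (p : ((Σ j, η (2 * j + 2)) →₀ ℕ) × Finset (Σ j, η (2 * j + 1))) : ℕ :=
  (p.1.sum fun e c => c * (2 * e.1 + 2)) + ∑ o ∈ p.2, (2 * o.1 + 1)

/-- The monomials of weight `n`, when there are `v i` generators of degree `i`. -/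
lemma exists_finset_monomialWeight (v : ℕ → ℕ) (n : ℕ) :
    ∃ T : Finset (((Σ j, Fin (v (2 * j + 2))) →₀ ℕ) × Finset (Σ j, Fin (v (2 * j + 1)))),
      (∀ p, p ∈ T ↔ monomialWeight (η := fun i => Fin (v i)) p = n) ∧
      (T.card : ℚ) =
        coeff n (∏ i ∈ Finset.range (2 * n), superFactor (i + 1) ^ v (i + 1)) := by
  classical
  set sE := (Finset.range n).sigma fun j => (Finset.univ : Finset (Fin (v (2 * j + 2)))) with hsE
  set sO := (Finset.range n).sigma fun j => (Finset.univ : Finset (Fin (v (2 * j + 1)))) with hsO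
  set FE := exponentsOfWeight sE fun e => 2 * e.1 + 2 with hFE
  set FO := fun m => sO.powerset.filter fun S => ∑ o ∈ S, (2 * o.1 + 1) = m with hFO
  have hd : ∀ e ∈ sE, 1 ≤ 2 * e.1 + 2 := fun e _ => by omega
  have hsum : ∀ a : (Σ j, Fin (v (2 * j + 2))) →₀ ℕ, a.support ⊆ sE →
      ∑ e ∈ sE, a e * (2 * e.1 + 2) = a.sum fun e c => c * (2 * e.1 + 2) := fun a ha =>
    (Finsupp.sum_of_support_subset a ha (fun e c => c * (2 * e.1 + 2)) fun _ _ => zero_mul _).symm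
  refine ⟨(Finset.HasAntidiagonal.antidiagonal n).biUnion fun q => FE q.1 ×ˢ FO q.2, ?_, ?_⟩
  · rintro ⟨a, S⟩
    simp only [Finset.mem_biUnion, Finset.HasAntidiagonal.mem_antidiagonal, Finset.mem_product,
      hFE, mem_exponentsOfWeight hd, hFO, Finset.mem_filter, Finset.mem_powerset, monomialWeight]
    constructor
    · rintro ⟨q, hq, ⟨h1, h2⟩, -, h4⟩
      rw [← hsum a h1, h2, h4, hq]
    · intro h
      -- A generator of degree `2j + 2` or `2j + 1` that occurs in weight `n` has `j < n`, so the
      -- finite sets `sE` and `sO` suffice.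
      have ha : a.support ⊆ sE := by
        intro e he
        rw [hsE, Finset.mem_sigma, Finset.mem_range]
        refine ⟨?_, Finset.mem_univ _⟩
        have h1 : a e * (2 * e.1 + 2) ≤ a.sum fun e c => c * (2 * e.1 + 2) :=
          Finset.single_le_sum (f := fun e => a e * (2 * e.1 + 2)) (fun _ _ => Nat.zero_le _) he
        have h2 : 2 * e.1 + 2 ≤ a e * (2 * e.1 + 2) :=
          Nat.le_mul_of_pos_left _ (Nat.pos_of_ne_zero (Finsupp.mem_support_iff.mp he))
        omega
      have hS : S ⊆ sO := by
        intro o ho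
        rw [hsO, Finset.mem_sigma, Finset.mem_range]
        refine ⟨?_, Finset.mem_univ _⟩
        have h1 := Finset.single_le_sum (f := fun o : (Σ j, Fin (v (2 * j + 1))) => 2 * o.1 + 1)
          (fun _ _ => Nat.zero_le _) ho
        omega
      exact ⟨(_, _), h, ⟨ha, hsum a ha⟩, hS, rfl⟩
  · rw [prod_superFactor_range_two_mul, coeff_mul, Finset.card_biUnion]
    · push_cast
      refine Finset.sum_congr rfl fun q _ => ?_
      rw [Finset.card_product, coeff_prod_one_sub_X_pow_inv sE hd, coeff_prod_one_add_X_pow]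
      push_cast
      rfl
    · intro q _ q' _ hne
      rw [Function.onFun, Finset.disjoint_left]
      rintro ⟨a, S⟩ h1 h2
      rw [Finset.mem_product, mem_exponentsOfWeight hd, Finset.mem_filter] at h1 h2
      exact hne (Prod.ext (h1.1.2.symm.trans h2.1.2) (h1.2.2.symm.trans h2.2.2))

end Counting

end FlagComplex

namespace FlagComplex

open scoped DirectSum TensorProduct
open Module

/-! ### Monomial basis of `S(V)` and its graded pieces -/

section Basis

variable {k : Type*} [Field k] {V : ℕ → Type*} [∀ i, AddCommGroup (V i)] [∀ i, Module k (V i)]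
  {η : ℕ → Type*} (b : ∀ i, Basis (η i) k (V i))

lemma dfinsupp_basis_apply (j : ℕ) (i : η j) :
    DFinsupp.basis b ⟨j, i⟩ = DFinsupp.single j (b j i) := by
  rw [Basis.apply_eq_iff]
  ext ⟨j', i'⟩
  change (b j').repr (DFinsupp.single j (b j i) j') i' = _
  by_cases h : j = j'
  · subst h
    simp [Finsupp.single_apply_left sigma_mk_injective]
  · rw [DFinsupp.single_eq_of_ne (Ne.symm h), Finsupp.single_eq_of_ne]
    · simp
    · intro h'
      exact h (congrArg Sigma.fst h').symm

/-- The basis of the even part of `V`. -/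
noncomputable def evenBasis : Basis (Σ j, η (2 * j + 2)) k (⨁ j : ℕ, V (2 * j + 2)) :=
  DFinsupp.basis fun j => b (2 * j + 2)

/-- The basis of the odd part of `V`. -/
noncomputable def oddBasis : Basis (Σ j, η (2 * j + 1)) k (⨁ j : ℕ, V (2 * j + 1)) :=
  DFinsupp.basis fun j => b (2 * j + 1)

lemma evenBasis_apply (j : ℕ) (i : η (2 * j + 2)) : evenBasis b ⟨j, i⟩ =
    DirectSum.lof k ℕ (fun j => V (2 * j + 2)) j (b _ i) :=
  dfinsupp_basis_apply (fun j => b (2 * j + 2)) j i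

lemma oddBasis_apply (j : ℕ) (i : η (2 * j + 1)) : oddBasis b ⟨j, i⟩ =
    DirectSum.lof k ℕ (fun j => V (2 * j + 1)) j (b _ i) :=
  dfinsupp_basis_apply (fun j => b (2 * j + 1)) j i

variable [LinearOrder (Σ j, η (2 * j + 1))]

/-- The basis of monomials of `S(V)`. -/
noncomputable def monomialBasis : Basis (((Σ j, η (2 * j + 2)) →₀ ℕ) × Finset (Σ j, η (2 * j + 1)))
    k (FreeGradedComm k V) :=
  (evenBasis b).symmetricAlgebra.tensorProduct (oddBasis b).ExteriorAlgebra

lemma monomialBasis_apply (a : (Σ j, η (2 * j + 2)) →₀ ℕ) (S : Finset (Σ j, η (2 * j + 1))) :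
    monomialBasis b (a, S) = (evenBasis b).symmetricAlgebra a ⊗ₜ (oddBasis b).ExteriorAlgebra S :=
  Basis.tensorProduct_apply _ _ _ _

lemma symmetricAlgebra_basis_zero {κ M : Type*} [AddCommGroup M] [Module k M] (c : Basis κ k M) :
    c.symmetricAlgebra 0 = 1 := by
  simp [Basis.symmetricAlgebra, ← MvPolynomial.C_apply]

lemma ι_mul_symmetricAlgebra_basis {κ M : Type*} [AddCommGroup M] [Module k M] (c : Basis κ k M)
    (e : κ) (a : κ →₀ ℕ) : SymmetricAlgebra.ι k M (c e) * c.symmetricAlgebra a =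
      c.symmetricAlgebra (Finsupp.single e 1 + a) := by
  rw [← SymmetricAlgebra.equivMvPolynomial_symm_X]
  simp [Basis.symmetricAlgebra, ← map_mul, MvPolynomial.X, MvPolynomial.monomial_mul]

lemma exteriorAlgebra_basis_empty {κ M : Type*} [LinearOrder κ] [AddCommGroup M] [Module k M]
    (c : Basis κ k M) : c.ExteriorAlgebra ∅ = 1 := by
  rw [ExteriorAlgebra.basis_apply_ofCard c (n := 0) rfl]
  simp [ExteriorAlgebra.ιMulti_family]

lemma exteriorAlgebra_basis_singleton {κ M : Type*} [LinearOrder κ] [AddCommGroup M] [Module k M]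
    (c : Basis κ k M) (o : κ) : c.ExteriorAlgebra {o} = ExteriorAlgebra.ι k (c o) := by
  rw [ExteriorAlgebra.basis_apply_ofCard c (n := 1) (by simp)]
  simp [ExteriorAlgebra.ιMulti_family, Set.powersetCard.ofFinEmbEquiv_symm_apply]

lemma ι_mul_exteriorAlgebra_basis_of_mem {κ M : Type*} [LinearOrder κ] [AddCommGroup M]
    [Module k M] (c : Basis κ k M) {o : κ} {S : Finset κ} (h : o ∈ S) :
    ExteriorAlgebra.ι k (c o) * c.ExteriorAlgebra S = 0 := by
  rw [← exteriorAlgebra_basis_singleton]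
  exact ExteriorAlgebra.basis_mul_of_not_disjoint c
    (Set.powersetCard.ofCard (s := {o}) rfl) (Set.powersetCard.ofCard (s := S) rfl) (by simpa)

/-- The unit is the sign of moving `o` into its place in the order; its value does not matter for
spans. -/
lemma ι_mul_exteriorAlgebra_basis_of_notMem {κ M : Type*} [LinearOrder κ] [AddCommGroup M]
    [Module k M] (c : Basis κ k M) {o : κ} {S : Finset κ} (h : o ∉ S) :
    ∃ u : ℤˣ, ExteriorAlgebra.ι k (c o) * c.ExteriorAlgebra S = u • c.ExteriorAlgebra (insert o S) := by
  rw [← exteriorAlgebra_basis_singleton]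
  have := ExteriorAlgebra.basis_mul_of_disjoint c
    (Set.powersetCard.ofCard (s := {o}) rfl) (Set.powersetCard.ofCard (s := S) rfl) (by simpa)
  rw [Set.powersetCard.coe_disjUnion] at this
  simp only [Set.powersetCard.val_ofCard, Finset.disjUnion_eq_union, Finset.singleton_union] at this
  exact ⟨_, this⟩

lemma evenGen_mul_monomialBasis (j : ℕ) (i : η (2 * j + 2)) (a : (Σ j, η (2 * j + 2)) →₀ ℕ)
    (S : Finset (Σ j, η (2 * j + 1))) : evenGen k V j (b _ i) * monomialBasis b (a, S) =
      monomialBasis b (Finsupp.single ⟨j, i⟩ 1 + a, S) := by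
  rw [evenGen, ← evenBasis_apply, monomialBasis_apply, monomialBasis_apply,
    Algebra.TensorProduct.tmul_mul_tmul, one_mul, ι_mul_symmetricAlgebra_basis]

lemma oddGen_mul_monomialBasis_of_mem (j : ℕ) (i : η (2 * j + 1))
    (a : (Σ j, η (2 * j + 2)) →₀ ℕ) {S : Finset (Σ j, η (2 * j + 1))} (h : ⟨j, i⟩ ∈ S) :
    oddGen k V j (b _ i) * monomialBasis b (a, S) = 0 := by
  rw [oddGen, ← oddBasis_apply, monomialBasis_apply, Algebra.TensorProduct.tmul_mul_tmul,
    ι_mul_exteriorAlgebra_basis_of_mem _ h, TensorProduct.tmul_zero]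

lemma oddGen_mul_monomialBasis_of_notMem (j : ℕ) (i : η (2 * j + 1))
    (a : (Σ j, η (2 * j + 2)) →₀ ℕ) {S : Finset (Σ j, η (2 * j + 1))} (h : ⟨j, i⟩ ∉ S) :
    oddGen k V j (b _ i) * monomialBasis b (a, S) = monomialBasis b (a, insert ⟨j, i⟩ S) ∨
    oddGen k V j (b _ i) * monomialBasis b (a, S) = -monomialBasis b (a, insert ⟨j, i⟩ S) := by
  obtain ⟨u, hu⟩ := ι_mul_exteriorAlgebra_basis_of_notMem (oddBasis b) h
  rw [oddGen, ← oddBasis_apply, monomialBasis_apply, monomialBasis_apply,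
    Algebra.TensorProduct.tmul_mul_tmul, hu, one_mul]
  rcases Int.units_eq_one_or u with rfl | rfl
  · left
    rw [one_smul]
  · right
    rw [Units.neg_smul, one_smul, TensorProduct.tmul_neg]

lemma monomialBasis_zero_empty : monomialBasis b (0, ∅) = 1 := by
  rw [monomialBasis_apply, symmetricAlgebra_basis_zero, exteriorAlgebra_basis_empty]
  rfl

omit [LinearOrder (Σ j, η (2 * j + 1))] in
lemma monomialWeight_single_add (e : Σ j, η (2 * j + 2)) (a : (Σ j, η (2 * j + 2)) →₀ ℕ)
    (S : Finset (Σ j, η (2 * j + 1))) :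
    monomialWeight (Finsupp.single e 1 + a, S) = 2 * e.1 + 2 + monomialWeight (a, S) := by
  classical
  simp only [monomialWeight]
  rw [Finsupp.sum_add_index' (by simp) (by intros; ring), Finsupp.sum_single_index (by simp)]
  ring

lemma monomialWeight_insert (a : (Σ j, η (2 * j + 2)) →₀ ℕ) {o : Σ j, η (2 * j + 1)}
    {S : Finset (Σ j, η (2 * j + 1))} (h : o ∉ S) :
    monomialWeight (a, insert o S) = 2 * o.1 + 1 + monomialWeight (a, S) := by
  simp only [monomialWeight]
  rw [Finset.sum_insert h]
  ring

variable (k V) in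
lemma evenGen_add (j : ℕ) (v w : V (2 * j + 2)) :
    evenGen k V j (v + w) = evenGen k V j v + evenGen k V j w := by
  simp [evenGen, TensorProduct.add_tmul]

variable (k V) in
lemma evenGen_smul (j : ℕ) (c : k) (v : V (2 * j + 2)) :
    evenGen k V j (c • v) = c • evenGen k V j v := by
  simp [evenGen, TensorProduct.smul_tmul']

variable (k V) in
lemma oddGen_add (j : ℕ) (v w : V (2 * j + 1)) :
    oddGen k V j (v + w) = oddGen k V j v + oddGen k V j w := by
  simp [oddGen, TensorProduct.tmul_add]

variable (k V) in
lemma oddGen_smul (j : ℕ) (c : k) (v : V (2 * j + 1)) :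
    oddGen k V j (c • v) = c • oddGen k V j v := by
  simp [oddGen]

/-- The span of the basis monomials of weight `n`. -/
noncomputable def weightSpan (n : ℕ) : Submodule k (FreeGradedComm k V) :=
  Submodule.span k (monomialBasis b '' {p | monomialWeight p = n})

lemma monomialBasis_mem_weightSpan {p : ((Σ j, η (2 * j + 2)) →₀ ℕ) × Finset (Σ j, η (2 * j + 1))}
    {n : ℕ} (h : monomialWeight p = n) : monomialBasis b p ∈ weightSpan b n :=
  Submodule.subset_span ⟨p, h, rfl⟩

lemma mul_mem_weightSpan {g : FreeGradedComm k V} {m n : ℕ}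
    (hg : ∀ p, monomialWeight p = n → g * monomialBasis b p ∈ weightSpan b m)
    {x : FreeGradedComm k V} (hx : x ∈ weightSpan b n) : g * x ∈ weightSpan b m := by
  induction hx using Submodule.span_induction with
  | mem x h => obtain ⟨p, hp, rfl⟩ := h; exact hg p hp
  | zero => rw [mul_zero]; exact zero_mem _
  | add x y _ _ hx hy => rw [mul_add]; exact add_mem hx hy
  | smul c x _ hx => rw [mul_smul_comm]; exact Submodule.smul_mem _ _ hx

lemma evenGen_mul_mem_weightSpan (j : ℕ) (v : V (2 * j + 2)) {n : ℕ} {x : FreeGradedComm k V}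
    (hx : x ∈ weightSpan b n) : evenGen k V j v * x ∈ weightSpan b (2 * j + 2 + n) := by
  have hv := (b (2 * j + 2)).mem_span v
  induction hv using Submodule.span_induction with
  | mem v h =>
    obtain ⟨i, rfl⟩ := h
    refine mul_mem_weightSpan b (fun p hp => ?_) hx
    rw [evenGen_mul_monomialBasis]
    exact monomialBasis_mem_weightSpan b (by rw [monomialWeight_single_add]; simp [hp])
  | zero =>
    have := evenGen_smul k V j 0 0
    rw [zero_smul, zero_smul] at this
    rw [this, zero_mul]
    exact zero_mem _
  | add v w _ _ hv hw => rw [evenGen_add, add_mul]; exact add_mem hv hw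
  | smul c v _ hv => rw [evenGen_smul, smul_mul_assoc]; exact Submodule.smul_mem _ _ hv

lemma oddGen_mul_mem_weightSpan (j : ℕ) (v : V (2 * j + 1)) {n : ℕ} {x : FreeGradedComm k V}
    (hx : x ∈ weightSpan b n) : oddGen k V j v * x ∈ weightSpan b (2 * j + 1 + n) := by
  have hv := (b (2 * j + 1)).mem_span v
  induction hv using Submodule.span_induction with
  | mem v h =>
    obtain ⟨i, rfl⟩ := h
    refine mul_mem_weightSpan b (fun p hp => ?_) hx
    obtain ⟨a, S⟩ := p
    by_cases h : (⟨j, i⟩ : Σ j, η (2 * j + 1)) ∈ S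
    · rw [oddGen_mul_monomialBasis_of_mem b j i a h]
      exact zero_mem _
    · have hm : monomialBasis b (a, insert ⟨j, i⟩ S) ∈ weightSpan b (2 * j + 1 + n) :=
        monomialBasis_mem_weightSpan b (by rw [monomialWeight_insert a h, hp])
      rcases oddGen_mul_monomialBasis_of_notMem b j i a h with h' | h'
      · rw [h']; exact hm
      · rw [h']; exact neg_mem hm
  | zero =>
    have := oddGen_smul k V j 0 0
    rw [zero_smul, zero_smul] at this
    rw [this, zero_mul]
    exact zero_mem _
  | add v w _ _ hv hw => rw [oddGen_add, add_mul]; exact add_mem hv hw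
  | smul c v _ hv => rw [oddGen_smul, smul_mul_assoc]; exact Submodule.smul_mem _ _ hv

lemma IsMonomial.mem_weightSpan {n : ℕ} {x : FreeGradedComm k V} (hx : IsMonomial k V n x) :
    x ∈ weightSpan b n := by
  induction hx with
  | one =>
    rw [← monomialBasis_zero_empty b]
    exact monomialBasis_mem_weightSpan b (by simp [monomialWeight])
  | even_mul j v _ ih => exact evenGen_mul_mem_weightSpan b j v ih
  | odd_mul j v _ ih => exact oddGen_mul_mem_weightSpan b j v ih

lemma isMonomial_monomialBasis_empty (a : (Σ j, η (2 * j + 2)) →₀ ℕ) :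
    IsMonomial k V (monomialWeight (a, (∅ : Finset (Σ j, η (2 * j + 1)))))
      (monomialBasis b (a, ∅)) := by
  induction a using Finsupp.induction with
  | zero =>
    rw [monomialBasis_zero_empty]
    simpa [monomialWeight] using IsMonomial.one
  | single_add e c a _ _ ih =>
    clear * - ih
    induction c with
    | zero => simpa using ih
    | succ c ihc =>
      rw [add_comm c 1, Finsupp.single_add, add_assoc, monomialWeight_single_add,
        ← evenGen_mul_monomialBasis]
      exact ihc.even_mul _ _

lemma monomialBasis_mem_gradedPiece
    (p : ((Σ j, η (2 * j + 2)) →₀ ℕ) × Finset (Σ j, η (2 * j + 1))) :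
    monomialBasis b p ∈ gradedPiece k V (monomialWeight p) := by
  obtain ⟨a, S⟩ := p
  -- A product of odd generators matches the ordered basis element only up to sign, so the sign is
  -- carried through the induction.
  suffices h : ∃ x, IsMonomial k V (monomialWeight (a, S)) x ∧
      (monomialBasis b (a, S) = x ∨ monomialBasis b (a, S) = -x) by
    obtain ⟨x, hx, h | h⟩ := h
    · rw [h]; exact Submodule.subset_span hx
    · rw [h]; exact neg_mem (Submodule.subset_span hx)
  induction S using Finset.induction_on with
  | empty => exact ⟨_, isMonomial_monomialBasis_empty b a, Or.inl rfl⟩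
  | insert o S ho ih =>
    obtain ⟨x, hx, h⟩ := ih
    refine ⟨oddGen k V o.1 (b _ o.2) * x, ?_, ?_⟩
    · rw [monomialWeight_insert a ho]
      exact hx.odd_mul _ _
    · rcases oddGen_mul_monomialBasis_of_notMem b o.1 o.2 a ho with h' | h' <;>
        rcases h with h | h <;> rw [h] at h'
      · exact Or.inl h'.symm
      · exact Or.inr (h'.symm.trans (map_neg (LinearMap.mulLeft k _) x))
      · exact Or.inr (by rw [h', neg_neg])
      · exact Or.inl (neg_injective (h'.symm.trans (map_neg (LinearMap.mulLeft k _) x)))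

/-- Multiplication by a basis generator sends a basis monomial to zero or to plus or minus another,
adding the degrees. Linearity extends this to arbitrary homogeneous generators. -/
lemma gradedPiece_eq_weightSpan (n : ℕ) : gradedPiece k V n = weightSpan b n := by
  apply le_antisymm
  · exact Submodule.span_le.mpr fun x hx => IsMonomial.mem_weightSpan b hx
  · rw [weightSpan, Submodule.span_le]
    rintro _ ⟨p, rfl, rfl⟩
    exact monomialBasis_mem_gradedPiece b p

lemma finrank_gradedPiece (b : ∀ i, Basis (η i) k (V i)) {n : ℕ}
    {T : Finset (((Σ j, η (2 * j + 2)) →₀ ℕ) × Finset (Σ j, η (2 * j + 1)))}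
    (hT : ∀ p, p ∈ T ↔ monomialWeight p = n) : finrank k (gradedPiece k V n) = T.card := by
  have h : monomialBasis b '' {p | monomialWeight p = n} =
      Set.range (monomialBasis b ∘ ((↑) : T → _)) := by
    ext x
    simp [hT]
  rw [gradedPiece_eq_weightSpan b, weightSpan, h,
    finrank_span_eq_card ((monomialBasis b).linearIndependent.comp _ Subtype.val_injective),
    Fintype.card_coe]

end Basis

theorem HasSuperExponents.eq_poincareSeries (k : Type*) [Field k] {Q : PowerSeries ℚ} {v : ℕ → ℕ}
    (hv : HasSuperExponents Q v) : Q = poincareSeries k (fun i => Fin (v i) → k) := by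
  classical
  -- The exterior basis needs some linear order on the odd generators; any will do, since only
  -- dimensions are read off.
  let _ : LinearOrder (Σ j, Fin (v (2 * j + 1))) := linearOrderOfSTO WellOrderingRel
  ext n
  obtain ⟨T, hT, hcard⟩ := exists_finset_monomialWeight v n
  rw [poincareSeries, PowerSeries.coeff_mk,
    finrank_gradedPiece (η := fun i => Fin (v i)) (fun i => Pi.basisFun k (Fin (v i))) hT, hcard, ← sub_eq_zero, ← map_sub]
  exact PowerSeries.X_pow_dvd_iff.mp (hv (2 * n)) n (by omega)

end FlagComplex

/-! ### The four statements -/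

theorem mainTheorem1 {ι : Type*} [Fintype ι] (K : AbstractSimplicialComplex ι)
    (hK : FlagComplex.IsFlag K) :
    (∀ N : ℕ, 1 ≤ N →
      0 ≤ (-1 : ℚ) ^ (N + 1) * ∑ d ∈ N.divisors, (ArithmeticFunction.moebius (N / d) : ℚ) *
        FlagComplex.newton (fun n => PowerSeries.coeff n (FlagComplex.flagSeries K)) d) ∧
    (∀ N : ℕ, 1 ≤ N →
      0 ≤ (-1 : ℤ) ^ N * ∑ d ∈ N.divisors, ArithmeticFunction.moebius (N / d) * (-1) ^ d *
        FlagComplex.newton (FlagComplex.alpha K) d) ∧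
    (∃ v : ℕ → ℕ,
      FlagComplex.flagSeries K = FlagComplex.poincareSeries ℚ (fun i => Fin (v i) → ℚ) ∧
      ∀ N : ℕ, 1 ≤ N →
        (-1 : ℤ) ^ N * ∑ d ∈ N.divisors, ArithmeticFunction.moebius (N / d) * (-1) ^ d *
          FlagComplex.newton (FlagComplex.alpha K) d = (N : ℤ) * (v N : ℤ)) ∧
    ((FlagComplex.faceNumber K 0).choose 3 : ℤ) -
        ((FlagComplex.faceNumber K 0 : ℤ) - 2) *
          (((FlagComplex.faceNumber K 0).choose 2 : ℤ) - (FlagComplex.faceNumber K 1 : ℤ)) ≤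
      (FlagComplex.faceNumber K 2 : ℤ) := by
  obtain ⟨v, hv, hN⟩ := hK.exists_superExponents
  have h2 : ∀ N : ℕ, 1 ≤ N → 0 ≤ (-1 : ℤ) ^ N * ∑ d ∈ N.divisors,
      ArithmeticFunction.moebius (N / d) * (-1) ^ d *
        FlagComplex.newton (FlagComplex.alpha K) d := fun N h => by
    rw [hN N h]
    positivity
  refine ⟨fun N h => ?_, h2, ⟨v, hv.eq_poincareSeries ℚ, hN⟩,
    FlagComplex.faceNumber_two_ineq K (h2 3 (by norm_num))⟩
  have h3 : (0 : ℚ) ≤ ((-1 : ℤ) ^ N * ∑ d ∈ N.divisors,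
      ArithmeticFunction.moebius (N / d) * (-1) ^ d *
        FlagComplex.newton (FlagComplex.alpha K) d : ℤ) := by
    exact_mod_cast h2 N h
  -- The two expressions agree because `(-1)^(N+1) * (-(-1)^d) = (-1)^N * (-1)^d`.
  refine h3.trans_eq ?_
  push_cast
  rw [pow_succ, mul_assoc]
  congr 1
  rw [Finset.mul_sum]
  refine Finset.sum_congr rfl fun d _ => ?_
  rw [FlagComplex.newton_coeff_flagSeries hK]
  ring
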